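/- Let $\mu>-1/2$ and let $d\lambda_\mu(x)=|x|^{2\mu}e^{-x^2}\,dx$ on $\mathbb R$. Put $$\gamma_\mu(2m)=\frac{2^{2m}\,m!\,\Gamma(m+\mu+\frac12)}{\Gamma(\mu+\frac12)},\qquad \gamma_\mu(2m+1)=\frac{2^{2m+1}\,m!\,\Gamma(m+\mu+\frac32)}{\Gamma(\mu+\frac12)},\qquad e_\mu(z)=\sum_{m=0}^\infty\frac{z^m}{\gamma_\mu(m)},$$ and, for $0<r<1$ and $x,y\in\mathbb R$, $$K_r(x,y)=\frac{1}{\Gamma(\mu+\frac12)(1-r^2)^{\mu+\frac12}}\;e^{-(x^2+y^2)\frac{r^2}{1-r^2}}\;e_\mu\!\left(\frac{2xyr}{1-r^2}\right).$$ The generalized Ornstein–Uhlenbeck semigroup is $T_\mu^tf(x)=\int_{\mathbb R}K_{e^{-t}}(x,y)f(y)\,d\lambda_\mu(y)$, $t>0$, and its maximal function is $T_\mu^*f(x)=\sup_{t>0}|T_\mu^tf(x)|\in[0,\infty]$. For every (real- or complex-valued) $f\in L^1(\lambda_\mu)$ the integrals defining $T_\mu^tf(x)$ converge absolutely for all $t>0$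 and $x\in\mathbb R$, and $T_\mu^*f$ is measurable. Moreover: (i) $T_\mu^*$ is of weak type $(1,1)$ with respect to $\lambda_\mu$: there is a constant $C>0$, depending only on $\mu$, such that for every $f\in L^1(\lambda_\mu)$ and every $\eta>0$, $$\lambda_\mu\{x\in\mathbb R: T_\mu^*f(x)>\eta\}\le\frac{C}{\eta}\int_{\mathbb R}|f|\,d\lambda_\mu .$$ (ii) $T_\mu^*$ is bounded on $L^\infty$: there is a constant $C>0$, depending only on $\mu$, such that $\|T_\mu^*f\|_\infty\le C\|f\|_\infty$ for every $f\in L^\infty(\lambda_\mu)$. -/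

import Mathlib

open MeasureTheory
open scoped ENNReal

namespace GenOU

noncomputable section

/-- The measure `dλ_μ(x) = |x|^{2μ} e^{-x²} dx` on the real line. -/
def lam (μ : ℝ) : Measure ℝ :=
  volume.withDensity fun x => ENNReal.ofReal (|x| ^ (2 * μ) * Real.exp (-x ^ 2))

/-- The generalized factorial: `γ_μ(2m) = 2^{2m} m! Γ(m+μ+1/2) / Γ(μ+1/2)` and
`γ_μ(2m+1) = 2^{2m+1} m! Γ(m+μ+3/2) / Γ(μ+1/2)`; here `n / 2` is the integer quotient `m`. -/
def genFactorial (μ : ℝ) (n : ℕ) : ℝ :=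
  if Even n then
    2 ^ n * ((n / 2).factorial : ℝ) * Real.Gamma (((n / 2 : ℕ) : ℝ) + μ + 1 / 2)
      / Real.Gamma (μ + 1 / 2)
  else
    2 ^ n * ((n / 2).factorial : ℝ) * Real.Gamma (((n / 2 : ℕ) : ℝ) + μ + 3 / 2)
      / Real.Gamma (μ + 1 / 2)

/-- The generalized exponential `e_μ(z) = ∑ z^m / γ_μ(m)`. -/
def genExp (μ z : ℝ) : ℝ := ∑' m : ℕ, z ^ m / genFactorial μ m

/-- The (generalized Mehler) kernel `K_r(x, y)`, `0 < r < 1`, with respect to `λ_μ`. -/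
def kernel (μ r x y : ℝ) : ℝ :=
  1 / (Real.Gamma (μ + 1 / 2) * (1 - r ^ 2) ^ (μ + 1 / 2))
    * Real.exp (-(x ^ 2 + y ^ 2) * (r ^ 2 / (1 - r ^ 2)))
    * genExp μ (2 * x * y * r / (1 - r ^ 2))

/-- The generalized Ornstein–Uhlenbeck semigroup
`T_μ^t f(x) = ∫ K_{e^{-t}}(x, y) f(y) dλ_μ(y)`. -/
def semigroup {𝕜 : Type*} [RCLike 𝕜] (μ t : ℝ) (f : ℝ → 𝕜) (x : ℝ) : 𝕜 :=
  ∫ y, kernel μ (Real.exp (-t)) x y • f y ∂(lam μ)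

/-- The maximal function `T_μ^* f(x) = sup_{t > 0} |T_μ^t f(x)|`, with values in `[0, ∞]`. -/
def maximal {𝕜 : Type*} [RCLike 𝕜] (μ : ℝ) (f : ℝ → 𝕜) (x : ℝ) : ℝ≥0∞ :=
  ⨆ (t : ℝ) (_ : 0 < t), ‖semigroup μ t f x‖ₑ

end

end GenOU

/-!
The proof compares the semigroup with an uncentred maximal function. As `γ_μ(n)` is of the order of
`n! (1 + n) ^ μ`, the generalized exponential satisfies `|e_μ(z)| ≲ (1 + |z|) ^ (-μ) * exp |z|`, and
the kernel inherits Gaussian bounds. As a function of `|y|` it is therefore dominated by a function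
which increases up to `|x|`, decreases from there on, and has `λ_μ`-mass bounded uniformly in `r`
and `x`. Integrating over superlevel sets, which are intervals around `|x|`, bounds `T_μ^* f(x)` by
a constant times the supremum of `ρ I / ν I` over the intervals `I ∋ |x|`, where `ν` and `ρ` are the
images of `λ_μ` and `|f| dλ_μ` under the absolute value.

For `f ∈ L^∞` these quotients are at most `‖f‖_∞`. The weak type estimate needs no doubling
property of `ν`: on a line, every finite family of intervals has a subfamily with the same union
which covers each point at most twice.
-/

namespace GenOU

open Set Filter Asymptotics
open scoped Finset Nat Topology

/-! ### Growth of the generalized factorials and exponential -/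

lemma exists_one_add_rpow_le_exp {m : ℝ} (hm : 0 ≤ m) {c : ℝ} (hc : 0 < c) :
    ∃ C : ℝ, 0 < C ∧ ∀ q : ℝ, 0 ≤ q → (1 + q) ^ m ≤ C * Real.exp (c * q) := by
  set M := max 1 (m / c)
  have hM : 1 ≤ M := le_max_left _ _
  have hmM : m ≤ c * M := (div_le_iff₀' hc).1 (le_max_right _ _)
  refine ⟨M ^ m, by positivity, fun q hq => ?_⟩
  have hbase : 1 + q ≤ M * Real.exp (q / M) :=
    calc 1 + q ≤ M * (q / M + 1) := by field_simp; linarith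
      _ ≤ M * Real.exp (q / M) := by gcongr; exact Real.add_one_le_exp _
  calc (1 + q) ^ m ≤ (M * Real.exp (q / M)) ^ m := by gcongr
    _ = M ^ m * Real.exp (q / M * m) := by
      rw [Real.mul_rpow (by positivity) (by positivity), ← Real.exp_mul]
    _ ≤ M ^ m * Real.exp (c * q) := by
      gcongr M ^ m * Real.exp ?_
      calc q / M * m ≤ q / M * (c * M) := by gcongr
        _ = c * q := by field_simp

lemma rpow_le_rpow_abs_mul_rpow {p q L : ℝ} (hp : 0 < p) (hq : 0 < q) (hL : 0 < L)
    (hpq : p ≤ L * q) (hqp : q ≤ L * p) (m : ℝ) : p ^ m ≤ L ^ |m| * q ^ m := by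
  rcases le_total 0 m with hm | hm
  · rw [abs_of_nonneg hm, ← Real.mul_rpow hL.le hq.le]
    exact Real.rpow_le_rpow hp.le hpq hm
  · rw [abs_of_nonpos hm, Real.rpow_neg hL.le, ← div_eq_inv_mul, ← Real.div_rpow hq.le hL.le]
    exact Real.rpow_le_rpow_of_nonpos (by positivity) ((div_le_iff₀' hL).2 hqp) hm

/-- A form of Peetre's inequality; in the applications `p` and `q` are weights at two points at
distance `√Q`, and the exponential is absorbed by a Gaussian. -/
lemma exists_rpow_le_exp_mul_rpow (m : ℝ) {c : ℝ} (hc : 0 < c) :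
    ∃ C : ℝ, 0 < C ∧ ∀ p q Q : ℝ, 0 < p → 0 < q → 0 ≤ Q → p ≤ 3 * (1 + Q) * q →
      q ≤ 3 * (1 + Q) * p → p ^ m ≤ C * Real.exp (c * Q) * q ^ m := by
  obtain ⟨C, hC, hexp⟩ := exists_one_add_rpow_le_exp (abs_nonneg m) hc
  refine ⟨3 ^ |m| * C, by positivity, fun p q Q hp hq hQ hpq hqp => ?_⟩
  calc p ^ m ≤ (3 * (1 + Q)) ^ |m| * q ^ m :=
        rpow_le_rpow_abs_mul_rpow hp hq (by positivity) hpq hqp m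
    _ = 3 ^ |m| * (1 + Q) ^ |m| * q ^ m := by rw [Real.mul_rpow (by norm_num) (by positivity)]
    _ ≤ 3 ^ |m| * (C * Real.exp (c * Q)) * q ^ m := by gcongr; exact hexp Q hQ
    _ = 3 ^ |m| * C * Real.exp (c * Q) * q ^ m := by ring

lemma Gamma_nat_add_eq_prod {a : ℝ} (ha : 0 < a) (n : ℕ) :
    Real.Gamma (n + a) = Real.Gamma a * ∏ j ∈ Finset.range n, (a + j) := by
  induction n with
  | zero => simp
  | succ n ih =>
    rw [Finset.prod_range_succ, ← mul_assoc, ← ih, Nat.cast_succ, add_right_comm,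
      Real.Gamma_add_one (by positivity), mul_comm, add_comm a]

lemma GammaSeq_eq_div_Gamma {a : ℝ} (ha : 0 < a) (n : ℕ) :
    Real.GammaSeq a n = n ^ a * n ! * Real.Gamma a / ((n + a) * Real.Gamma (n + a)) := by
  have hΓ := Real.Gamma_pos_of_pos ha
  rw [← Real.Gamma_add_one (by positivity), add_right_comm, ← Nat.cast_succ,
    Gamma_nat_add_eq_prod ha, mul_comm (Real.Gamma a), mul_div_mul_right _ _ hΓ.ne',
    Real.GammaSeq]

lemma tendsto_nat_add_div_nat_add (a b : ℝ) :
    Tendsto (fun n : ℕ => ((n : ℝ) + a) / (n + b)) atTop (𝓝 1) := by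
  have hlim := (tendsto_natCast_div_add_atTop b).div (tendsto_natCast_div_add_atTop a) one_ne_zero
  rw [div_one] at hlim
  refine hlim.congr' ?_
  filter_upwards [eventually_gt_atTop 0] with n hn
  have hn' : (n : ℝ) ≠ 0 := by positivity
  simp only [Pi.div_apply]
  field_simp

lemma tendsto_Gamma_mul_rpow_div_Gamma {a b : ℝ} (ha : 0 < a) (hb : 0 < b) :
    Tendsto (fun n : ℕ => Real.Gamma (n + a) * (n + 1) ^ (b - a) / Real.Gamma (n + b))
      atTop (𝓝 1) := by
  have hΓa := Real.Gamma_pos_of_pos ha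
  have hΓb := Real.Gamma_pos_of_pos hb
  have hseq := ((Real.GammaSeq_tendsto_Gamma b).div_const (Real.Gamma b)).div
    ((Real.GammaSeq_tendsto_Gamma a).div_const (Real.Gamma a)) (div_ne_zero hΓa.ne' hΓa.ne')
  have hpow := (tendsto_nat_add_div_nat_add 1 0).rpow_const (p := b - a) (Or.inl one_ne_zero)
  have hlim := (hseq.mul (tendsto_nat_add_div_nat_add b a)).mul hpow
  rw [div_self hΓa.ne', div_self hΓb.ne', div_one, Real.one_rpow, mul_one, mul_one] at hlim
  refine hlim.congr' ?_
  filter_upwards [eventually_gt_atTop 0] with n hn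
  have hn' : (0 : ℝ) < n := by positivity
  simp only [Pi.div_apply]
  rw [GammaSeq_eq_div_Gamma ha, GammaSeq_eq_div_Gamma hb, add_zero,
    Real.div_rpow (by positivity) hn'.le, Real.rpow_sub hn' b a]
  field_simp

lemma exists_Gamma_mul_rpow_le {a b : ℝ} (ha : 0 < a) (hb : 0 < b) :
    ∃ D : ℝ, 0 < D ∧ ∀ n : ℕ,
      Real.Gamma (n + a) * (n + 1) ^ (b - a) ≤ D * Real.Gamma (n + b) := by
  have hpos (n : ℕ) {c : ℝ} (hc : 0 < c) : 0 < Real.Gamma (n + c) :=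
    Real.Gamma_pos_of_pos (by positivity)
  have hO := isBigO_of_div_tendsto_nhds
    (Eventually.of_forall fun n h => absurd h (hpos n hb).ne') 1
    (tendsto_Gamma_mul_rpow_div_Gamma ha hb)
  obtain ⟨D, hD, hle⟩ := bound_of_isBigO_nat_atTop hO
  refine ⟨D, hD, fun n => (le_abs_self _).trans ?_⟩
  simpa only [Real.norm_eq_abs, abs_of_pos (hpos n hb)] using hle (hpos n hb).ne'

lemma genFactorial_pos {μ : ℝ} (hμ : -1 / 2 < μ) (n : ℕ) : 0 < genFactorial μ n := by
  have hpos (k : ℕ) {a : ℝ} (ha : 0 < μ + a) : 0 < Real.Gamma (k + μ + a) :=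
    Real.Gamma_pos_of_pos (by linarith [k.cast_nonneg (α := ℝ)])
  have hΓ : 0 < Real.Gamma (μ + 1 / 2) := Real.Gamma_pos_of_pos (by linarith)
  have hΓeven := hpos (n / 2) (a := 1 / 2) (by linarith)
  have hΓodd := hpos (n / 2) (a := 3 / 2) (by linarith)
  unfold genFactorial
  split_ifs <;> positivity

lemma genFactorial_succ {μ : ℝ} (hμ : -1 / 2 < μ) (n : ℕ) :
    genFactorial μ (n + 1) = (n + 1 + if Even n then 2 * μ else 0) * genFactorial μ n := by
  rcases Nat.even_or_odd' n with ⟨m, rfl | rfl⟩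
  · have hm : (m : ℝ) + μ + 1 / 2 ≠ 0 := by linarith [m.cast_nonneg (α := ℝ)]
    rw [genFactorial, genFactorial, if_neg (by simp), if_pos (by simp), if_pos (by simp),
      Nat.mul_div_cancel_left m two_pos, show (2 * m + 1) / 2 = m by omega,
      show (m : ℝ) + μ + 3 / 2 = m + μ + 1 / 2 + 1 by ring, Real.Gamma_add_one hm]
    push_cast
    ring
  · rw [genFactorial, genFactorial, if_pos (by simp [parity_simps]), if_neg (by simp),
      if_neg (by simp), show (2 * m + 1 + 1) / 2 = m + 1 by omega,
      show (2 * m + 1) / 2 = m by omega, Nat.factorial_succ]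
    push_cast
    ring_nf

lemma genFactorial_zero_left (n : ℕ) : genFactorial 0 n = n ! := by
  induction n with
  | zero => simp [genFactorial, (Real.Gamma_pos_of_pos (by norm_num : (0 : ℝ) < 2⁻¹)).ne']
  | succ n ih => rw [genFactorial_succ (by norm_num), ih, Nat.factorial_succ]; simp

lemma genFactorial_eq (μ : ℝ) (n : ℕ) :
    genFactorial μ n = 2 ^ n * (n / 2)! *
      Real.Gamma ((n / 2 : ℕ) + (μ + if Even n then 1 / 2 else 3 / 2)) /
      Real.Gamma (μ + 1 / 2) := by
  unfold genFactorial
  split_ifs <;> rw [add_assoc]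

lemma exists_genFactorial_zero_mul_rpow_le {μ : ℝ} (hμ : -1 / 2 < μ) :
    ∃ D : ℝ, 0 < D ∧ ∀ n : ℕ,
      genFactorial 0 n * ((n / 2 : ℕ) + 1) ^ μ ≤ D * genFactorial μ n := by
  have hΓ : 0 < Real.Gamma (μ + 1 / 2) := Real.Gamma_pos_of_pos (by linarith)
  obtain ⟨D₁, hD₁, heven⟩ := exists_Gamma_mul_rpow_le (a := 0 + 1 / 2) (b := μ + 1 / 2)
    (by norm_num) (by linarith)
  obtain ⟨D₂, hD₂, hodd⟩ := exists_Gamma_mul_rpow_le (a := 0 + 3 / 2) (b := μ + 3 / 2)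
    (by norm_num) (by linarith)
  refine ⟨(D₁ + D₂) * Real.Gamma (μ + 1 / 2) / Real.Gamma (0 + 1 / 2), by positivity,
    fun n => ?_⟩
  have hμe : 0 < μ + if Even n then 1 / 2 else 3 / 2 := by split_ifs <;> linarith
  rw [genFactorial_eq, genFactorial_eq]
  generalize n / 2 = k
  have hΓk : 0 < Real.Gamma (k + (μ + if Even n then 1 / 2 else 3 / 2)) :=
    Real.Gamma_pos_of_pos (by positivity)
  have hratio : Real.Gamma (k + (0 + if Even n then 1 / 2 else 3 / 2)) * (k + 1) ^ μ ≤
      (D₁ + D₂) * Real.Gamma (k + (μ + if Even n then 1 / 2 else 3 / 2)) := by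
    rw [add_mul]
    split_ifs at hΓk ⊢
    · have hle := heven k
      rw [add_sub_add_right_eq_sub, sub_zero] at hle
      exact le_add_of_le_of_nonneg hle (by positivity)
    · have hle := hodd k
      rw [add_sub_add_right_eq_sub, sub_zero] at hle
      exact le_add_of_nonneg_of_le (by positivity) hle
  calc _ = 2 ^ n * k ! / Real.Gamma (0 + 1 / 2) *
          (Real.Gamma (k + (0 + if Even n then 1 / 2 else 3 / 2)) * (k + 1) ^ μ) := by ring
    _ ≤ 2 ^ n * k ! / Real.Gamma (0 + 1 / 2) *
          ((D₁ + D₂) * Real.Gamma (k + (μ + if Even n then 1 / 2 else 3 / 2))) := by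
        gcongr 2 ^ n * k ! / _ * ?_
    _ = _ := by
        generalize Real.Gamma (μ + 1 / 2) = Γμ at hΓ ⊢
        field_simp

lemma exists_factorial_mul_rpow_le_genFactorial {μ : ℝ} (hμ : -1 / 2 < μ) :
    ∃ D : ℝ, 0 < D ∧ ∀ n : ℕ, (n ! : ℝ) * (1 + n) ^ μ ≤ D * genFactorial μ n := by
  obtain ⟨D, hD, hle⟩ := exists_genFactorial_zero_mul_rpow_le hμ
  refine ⟨2 ^ |μ| * D, by positivity, fun n => ?_⟩
  have hn : (n : ℝ) ≤ 2 * (n / 2 : ℕ) + 1 := by exact_mod_cast (by omega : n ≤ 2 * (n / 2) + 1)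
  have hn' : ((n / 2 : ℕ) : ℝ) ≤ n := by exact_mod_cast Nat.div_le_self n 2
  calc (n ! : ℝ) * (1 + n) ^ μ ≤ n ! * (2 ^ |μ| * ((n / 2 : ℕ) + 1) ^ μ) := by
        gcongr
        exact rpow_le_rpow_abs_mul_rpow (by positivity) (by positivity) two_pos (by linarith)
          (by linarith) μ
    _ = 2 ^ |μ| * (genFactorial 0 n * ((n / 2 : ℕ) + 1) ^ μ) := by
        rw [genFactorial_zero_left]; ring
    _ ≤ 2 ^ |μ| * (D * genFactorial μ n) := by gcongr 2 ^ |μ| * ?_; exact hle n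
    _ = 2 ^ |μ| * D * genFactorial μ n := by ring

lemma factorial_add_le (n k : ℕ) : (n + k)! ≤ (k + 1) ^ k * (n + 1) ^ k * n ! := by
  have hnk : n + k ≤ (k + 1) * (n + 1) := by nlinarith
  calc (n + k)! = n ! * (n + 1).ascFactorial k := (Nat.factorial_mul_ascFactorial n k).symm
    _ ≤ n ! * ((k + 1) * (n + 1)) ^ k := by
      gcongr
      exact (Nat.ascFactorial_le_pow_add n k).trans (Nat.pow_le_pow_left hnk k)
    _ = (k + 1) ^ k * (n + 1) ^ k * n ! := by rw [mul_pow]; ring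

lemma hasSum_pow_div_factorial (z : ℝ) : HasSum (fun n : ℕ => z ^ n / n !) (Real.exp z) := by
  rw [Real.exp_eq_exp_ℝ]
  exact NormedSpace.expSeries_div_hasSum_exp z

lemma hasSum_one_add_mul_pow_div_factorial (z : ℝ) :
    HasSum (fun n : ℕ => (1 + (n : ℝ)) * (z ^ n / n !)) ((1 + z) * Real.exp z) := by
  have hderiv : HasSum (fun n : ℕ => (n : ℝ) * (z ^ n / n !)) (z * Real.exp z) := by
    rw [← hasSum_nat_add_iff' 1]
    simp only [Finset.range_one, Finset.sum_singleton, Nat.cast_zero, zero_mul, sub_zero]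
    refine ((hasSum_pow_div_factorial z).mul_left z).congr_fun fun n => ?_
    rw [Nat.factorial_succ]
    push_cast
    field_simp
    ring
  simpa only [add_mul, one_mul] using (hasSum_pow_div_factorial z).add hderiv

lemma summable_pow_add_div_factorial (z : ℝ) (k : ℕ) :
    Summable fun n : ℕ => z ^ (n + k) / (n + k)! :=
  (summable_nat_add_iff (f := fun n : ℕ => z ^ n / (n ! : ℝ)) k).2
    (hasSum_pow_div_factorial z).summable

lemma tsum_pow_add_div_factorial_le {z : ℝ} (hz : 0 ≤ z) (k : ℕ) :
    ∑' n : ℕ, z ^ (n + k) / (n + k)! ≤ Real.exp z := by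
  have hsum := hasSum_pow_div_factorial z
  rw [← hsum.tsum_eq, ← hsum.summable.sum_add_tsum_nat_add k]
  exact le_add_of_nonneg_left (Finset.sum_nonneg fun i _ => by positivity)

lemma div_pow_mul_pow_div_factorial_le {z : ℝ} (hz : 0 ≤ z) (k n : ℕ) :
    ((1 + z) / (1 + n)) ^ k * (z ^ n / n !) ≤
      2 ^ k * (z ^ n / n ! + (k + 1) ^ k * (z ^ (n + k) / (n + k)!)) := by
  have hpow : (1 + z) ^ k ≤ 2 ^ k * (1 + z ^ k) :=
    calc (1 + z) ^ k ≤ 2 ^ (k - 1) * (1 ^ k + z ^ k) := add_pow_le zero_le_one hz k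
      _ ≤ 2 ^ k * (1 + z ^ k) := by
        rw [one_pow]
        gcongr
        · norm_num
        · omega
  have hone : 1 / (1 + (n : ℝ)) ^ k ≤ 1 :=
    div_le_one_of_le₀ (one_le_pow₀ (by linarith [n.cast_nonneg (α := ℝ)])) (by positivity)
  have hfact : 1 / (1 + (n : ℝ)) ^ k * (1 / n !) ≤ (k + 1) ^ k / (n + k)! := by
    rw [div_mul_div_comm, div_le_div_iff₀ (by positivity) (by positivity), one_mul, one_mul,
      add_comm 1 (n : ℝ), ← mul_assoc]
    exact_mod_cast factorial_add_le n k
  calc ((1 + z) / (1 + (n : ℝ))) ^ k * (z ^ n / n !)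
      = (1 + z) ^ k * (1 / (1 + (n : ℝ)) ^ k * (z ^ n / n !)) := by rw [div_pow]; ring
    _ ≤ 2 ^ k * (1 + z ^ k) * (1 / (1 + (n : ℝ)) ^ k * (z ^ n / n !)) := by gcongr
    _ = 2 ^ k * (1 / (1 + (n : ℝ)) ^ k * (z ^ n / n !) +
          z ^ (n + k) * (1 / (1 + (n : ℝ)) ^ k * (1 / n !))) := by ring
    _ ≤ 2 ^ k * (1 * (z ^ n / n !) + z ^ (n + k) * ((k + 1) ^ k / (n + k)!)) := by gcongr
    _ = 2 ^ k * (z ^ n / n ! + (k + 1) ^ k * (z ^ (n + k) / (n + k)!)) := by ring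

lemma rpow_le_self_add_inv_pow {t s : ℝ} (ht : 0 < t) (hs : s ≤ 1) {k : ℕ} (hk : -s ≤ k) :
    t ^ s ≤ t + t⁻¹ ^ k := by
  have hinv : 0 < t⁻¹ ^ k := by positivity
  rcases le_total 1 t with h1 | h1
  · have hle := Real.rpow_le_rpow_of_exponent_le h1 hs
    rw [Real.rpow_one] at hle
    linarith
  · have hle := Real.rpow_le_rpow_of_exponent_ge ht h1 (neg_le.1 hk)
    rw [Real.rpow_neg ht.le, Real.rpow_natCast, ← inv_pow] at hle
    linarith

lemma exists_tsum_one_add_rpow_mul_le {s : ℝ} (hs : s ≤ 1) :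
    ∃ A : ℝ, 0 < A ∧ ∀ z : ℝ, 0 ≤ z →
      Summable (fun n : ℕ => (1 + (n : ℝ)) ^ s * (z ^ n / n !)) ∧
      ∑' n : ℕ, (1 + (n : ℝ)) ^ s * (z ^ n / n !) ≤ A * ((1 + z) ^ s * Real.exp z) := by
  obtain ⟨k, hk⟩ := exists_nat_ge (-s)
  refine ⟨1 + 2 ^ k * (1 + (k + 1) ^ k), by positivity, fun z hz => ?_⟩
  have hz1 : 0 < 1 + z := by linarith
  have hterm (n : ℕ) : (1 + (n : ℝ)) ^ s * (z ^ n / n !) ≤ (1 + z) ^ s *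
      ((1 + z)⁻¹ * ((1 + n) * (z ^ n / n !)) +
        2 ^ k * (z ^ n / n ! + (k + 1) ^ k * (z ^ (n + k) / (n + k)!))) := by
    have hn1 : 0 < 1 + (n : ℝ) := by positivity
    calc (1 + (n : ℝ)) ^ s * (z ^ n / n !)
        = (1 + z) ^ s * (((1 + n) / (1 + z)) ^ s * (z ^ n / n !)) := by
          rw [Real.div_rpow hn1.le hz1.le]
          field_simp
      _ ≤ (1 + z) ^ s *
          (((1 + n) / (1 + z) + ((1 + n) / (1 + z))⁻¹ ^ k) * (z ^ n / n !)) := by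
          gcongr
          exact rpow_le_self_add_inv_pow (by positivity) hs hk
      _ = (1 + z) ^ s * ((1 + z)⁻¹ * ((1 + n) * (z ^ n / n !)) +
          ((1 + z) / (1 + n)) ^ k * (z ^ n / n !)) := by rw [inv_div]; ring
      _ ≤ _ := by
          gcongr (1 + z) ^ s * (_ + ?_)
          exact div_pow_mul_pow_div_factorial_le hz k n
  have hexp := hasSum_pow_div_factorial z
  have hbound := (((hasSum_one_add_mul_pow_div_factorial z).mul_left (1 + z)⁻¹).add
    ((hexp.add ((summable_pow_add_div_factorial z k).hasSum.mul_left ((k + 1 : ℝ) ^ k))).mul_left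
      (2 ^ k))).mul_left ((1 + z) ^ s)
  have hsum : Summable fun n : ℕ => (1 + (n : ℝ)) ^ s * (z ^ n / n !) :=
    .of_nonneg_of_le (fun n => by positivity) hterm hbound.summable
  refine ⟨hsum, (hasSum_le hterm hsum.hasSum hbound).trans ?_⟩
  rw [inv_mul_cancel_left₀ hz1.ne']
  calc _ ≤ (1 + z) ^ s * (Real.exp z + 2 ^ k * (Real.exp z + (k + 1) ^ k * Real.exp z)) := by
        gcongr
        exact tsum_pow_add_div_factorial_le hz k
    _ = (1 + 2 ^ k * (1 + (k + 1) ^ k)) * ((1 + z) ^ s * Real.exp z) := by ring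

lemma exists_tsum_pow_div_genFactorial_le {μ : ℝ} (hμ : -1 / 2 < μ) :
    ∃ A : ℝ, 0 < A ∧ ∀ z : ℝ, 0 ≤ z → Summable (fun n : ℕ => z ^ n / genFactorial μ n) ∧
      ∑' n : ℕ, z ^ n / genFactorial μ n ≤ A * ((1 + z) ^ (-μ) * Real.exp z) := by
  obtain ⟨D, hD, hfact⟩ := exists_factorial_mul_rpow_le_genFactorial hμ
  obtain ⟨A, hA, htsum⟩ := exists_tsum_one_add_rpow_mul_le (by linarith : -μ ≤ 1)
  refine ⟨D * A, by positivity, fun z hz => ?_⟩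
  obtain ⟨hsum, hle⟩ := htsum z hz
  have hterm (n : ℕ) :
      z ^ n / genFactorial μ n ≤ D * ((1 + (n : ℝ)) ^ (-μ) * (z ^ n / n !)) := by
    have hγ := genFactorial_pos hμ n
    rw [Real.rpow_neg (by positivity), div_le_iff₀ hγ]
    calc z ^ n = (((1 + (n : ℝ)) ^ μ)⁻¹ * (z ^ n / n !)) * (n ! * (1 + n) ^ μ) := by field_simp
      _ ≤ (((1 + (n : ℝ)) ^ μ)⁻¹ * (z ^ n / n !)) * (D * genFactorial μ n) := by
        gcongr ((1 + (n : ℝ)) ^ μ)⁻¹ * (z ^ n / n !) * ?_; exact hfact n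
      _ = D * (((1 + (n : ℝ)) ^ μ)⁻¹ * (z ^ n / n !)) * genFactorial μ n := by ring
  have hsumγ : Summable fun n : ℕ => z ^ n / genFactorial μ n :=
    .of_nonneg_of_le (fun n => div_nonneg (by positivity) (genFactorial_pos hμ n).le) hterm
      (hsum.mul_left D)
  refine ⟨hsumγ, (hsumγ.tsum_le_tsum hterm (hsum.mul_left D)).trans ?_⟩
  rw [tsum_mul_left, mul_assoc]
  gcongr

lemma norm_pow_div_genFactorial {μ : ℝ} (hμ : -1 / 2 < μ) (z : ℝ) (n : ℕ) :
    ‖z ^ n / genFactorial μ n‖ = |z| ^ n / genFactorial μ n := by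
  rw [Real.norm_eq_abs, abs_div, abs_pow, abs_of_pos (genFactorial_pos hμ n)]

lemma exists_abs_genExp_le {μ : ℝ} (hμ : -1 / 2 < μ) :
    ∃ A : ℝ, 0 < A ∧ ∀ z : ℝ, |genExp μ z| ≤ A * ((1 + |z|) ^ (-μ) * Real.exp |z|) := by
  obtain ⟨A, hA, htsum⟩ := exists_tsum_pow_div_genFactorial_le hμ
  refine ⟨A, hA, fun z => ?_⟩
  obtain ⟨hsum, hle⟩ := htsum |z| (abs_nonneg z)
  simp only [← norm_pow_div_genFactorial hμ] at hsum hle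
  exact (norm_tsum_le_tsum_norm hsum).trans hle

lemma continuous_genExp {μ : ℝ} (hμ : -1 / 2 < μ) : Continuous (genExp μ) := by
  obtain ⟨_, _, htsum⟩ := exists_tsum_pow_div_genFactorial_le hμ
  have hball (R : ℝ) (hR : 0 ≤ R) : ContinuousOn (genExp μ) (Metric.ball 0 R) := by
    refine continuousOn_tsum (fun n => by fun_prop) (htsum R hR).1 fun n z hz => ?_
    have hγ := genFactorial_pos hμ n
    rw [norm_pow_div_genFactorial hμ]
    gcongr
    exact (mem_ball_zero_iff.1 hz).le
  rw [continuous_iff_continuousAt]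
  exact fun z => (hball (|z| + 1) (by positivity)).continuousAt
    (Metric.isOpen_ball.mem_nhds (mem_ball_zero_iff.2 (lt_add_one _)))

/-! ### Gaussian bounds for the kernel -/

noncomputable section

/-- The Gaussian profile `exp (-(y - b) ^ 2 / (2 * s))`, normalized so that its integral against
`|y| ^ (2 * μ) dy` over the half-line is bounded uniformly in the centre `b` and the variance
`s`. -/
def weightedGaussian (μ s b y : ℝ) : ℝ :=
  s ^ (-1 / 2 : ℝ) * (s + b ^ 2) ^ (-μ) * Real.exp (-(y - b) ^ 2 / (2 * s))

end

lemma weightedGaussian_nonneg (μ b y : ℝ) {s : ℝ} (hs : 0 < s) :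
    0 ≤ weightedGaussian μ s b y := by
  unfold weightedGaussian
  positivity

lemma measurable_weightedGaussian (μ s b : ℝ) : Measurable (weightedGaussian μ s b) := by
  unfold weightedGaussian
  fun_prop

lemma exists_abs_kernel_le_rpow_mul_exp {μ : ℝ} (hμ : -1 / 2 < μ) :
    ∃ C : ℝ, 0 < C ∧ ∀ r s w x y : ℝ, 0 < r → 0 < s → s = 1 - r ^ 2 → w = r * |x| * |y| →
      |kernel μ r x y| ≤ C * (s ^ (-1 / 2 : ℝ) * (s + 2 * w) ^ (-μ) *
        Real.exp ((2 * w - (x ^ 2 + y ^ 2) * r ^ 2) / s)) := by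
  obtain ⟨A, hA, hle⟩ := exists_abs_genExp_le hμ
  have hΓ : 0 < Real.Gamma (μ + 1 / 2) := Real.Gamma_pos_of_pos (by linarith)
  refine ⟨A / Real.Gamma (μ + 1 / 2), by positivity, fun r s w x y hr hs hsr hw => ?_⟩
  have hw₀ : 0 ≤ w := by rw [hw]; positivity
  have hz : |2 * x * y * r / s| = 2 * w / s := by
    rw [abs_div, abs_of_pos hs, abs_mul, abs_mul, abs_mul, abs_of_pos hr, abs_two, hw]
    ring
  have hpow : (s ^ (μ + 1 / 2))⁻¹ * (1 + 2 * w / s) ^ (-μ) =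
      s ^ (-1 / 2 : ℝ) * (s + 2 * w) ^ (-μ) := by
    rw [show 1 + 2 * w / s = (s + 2 * w) / s by field_simp,
      Real.div_rpow (by positivity) hs.le, ← Real.rpow_neg hs.le,
      show (-(μ + 1 / 2)) = -1 / 2 + -μ by ring, Real.rpow_add hs]
    field_simp
  have hexp := hle (2 * x * y * r / s)
  rw [hz] at hexp
  rw [kernel, ← hsr, abs_mul, abs_mul, abs_of_pos (by positivity : 0 < 1 /
    (Real.Gamma (μ + 1 / 2) * s ^ (μ + 1 / 2))), Real.abs_exp]
  calc _ ≤ 1 / (Real.Gamma (μ + 1 / 2) * s ^ (μ + 1 / 2)) *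
        Real.exp (-(x ^ 2 + y ^ 2) * (r ^ 2 / s)) *
        (A * ((1 + 2 * w / s) ^ (-μ) * Real.exp (2 * w / s))) := by gcongr
    _ = A / Real.Gamma (μ + 1 / 2) * ((s ^ (μ + 1 / 2))⁻¹ * (1 + 2 * w / s) ^ (-μ) *
        (Real.exp (-(x ^ 2 + y ^ 2) * (r ^ 2 / s)) * Real.exp (2 * w / s))) := by
      generalize Real.Gamma (μ + 1 / 2) = Γμ at hΓ ⊢
      field_simp
    _ = _ := by
      rw [hpow, ← Real.exp_add]
      congr 3
      ring

/-- The freedom in splitting `r * |x| * |y|` is exploited by the unimodal majorant, which takes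
`(p, q) = (r * |x|, |y|)` for `|y| ≤ |x|` and `(p, q) = (|x|, r * |y|)` for `|x| ≤ |y|`. -/
lemma exists_abs_kernel_le_weightedGaussian {μ : ℝ} (hμ : -1 / 2 < μ) :
    ∃ C : ℝ, 0 < C ∧ ∀ r s p q x y : ℝ, 0 < r → 0 < s → s = 1 - r ^ 2 → 0 ≤ p → 0 ≤ q →
      p * q = r * |x| * |y| → |kernel μ r x y| ≤
        C * (Real.exp ((p ^ 2 + q ^ 2 - (x ^ 2 + y ^ 2) * r ^ 2) / s) *
          weightedGaussian μ s p q) := by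
  obtain ⟨C₁, hC₁, hkernel⟩ := exists_abs_kernel_le_rpow_mul_exp hμ
  obtain ⟨C₂, hC₂, hpeetre⟩ := exists_rpow_le_exp_mul_rpow (-μ) one_half_pos
  refine ⟨C₁ * C₂, by positivity, fun r s p q x y hr hs hsr hp hq hpq => ?_⟩
  set Q := (p - q) ^ 2 / s with hQ
  have hQs : Q * s = (p - q) ^ 2 := by rw [hQ]; field_simp
  have hQ₀ : 0 ≤ Q := by positivity
  have hpq₀ : 0 ≤ p * q := by positivity
  have hweight : (s + 2 * (p * q)) ^ (-μ) ≤
      C₂ * Real.exp (1 / 2 * Q) * (s + p ^ 2) ^ (-μ) :=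
    hpeetre _ _ Q (by positivity) (by positivity) hQ₀
      (by nlinarith [mul_nonneg hQ₀ (sq_nonneg p), sq_nonneg (2 * p - q)])
      (by nlinarith [mul_nonneg hQ₀ hpq₀])
  calc |kernel μ r x y| ≤ _ := hkernel r s (p * q) x y hr hs hsr hpq
    _ ≤ C₁ * (s ^ (-1 / 2 : ℝ) * (C₂ * Real.exp (1 / 2 * Q) * (s + p ^ 2) ^ (-μ)) *
          Real.exp ((2 * (p * q) - (x ^ 2 + y ^ 2) * r ^ 2) / s)) := by gcongr
    _ = C₁ * C₂ * (s ^ (-1 / 2 : ℝ) * (s + p ^ 2) ^ (-μ) * (Real.exp (1 / 2 * Q) *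
          Real.exp ((2 * (p * q) - (x ^ 2 + y ^ 2) * r ^ 2) / s))) := by ring
    _ = C₁ * C₂ * (s ^ (-1 / 2 : ℝ) * (s + p ^ 2) ^ (-μ) *
          (Real.exp ((p ^ 2 + q ^ 2 - (x ^ 2 + y ^ 2) * r ^ 2) / s) *
            Real.exp (-(q - p) ^ 2 / (2 * s)))) := by
      rw [← Real.exp_add, ← Real.exp_add, hQ]
      congr 3
      field_simp
      ring
    _ = _ := by rw [weightedGaussian]; ring

lemma lintegral_comp_abs (h : ℝ → ℝ≥0∞) : ∫⁻ y : ℝ, h |y| = 2 * ∫⁻ y in Ioi (0 : ℝ), h y := by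
  have hpos : ∫⁻ y in Ioi (0 : ℝ), h |y| = ∫⁻ y in Ioi (0 : ℝ), h y :=
    setLIntegral_congr_fun measurableSet_Ioi fun y (hy : 0 < y) => by rw [abs_of_pos hy]
  have hneg : ∫⁻ y in Iio (0 : ℝ), h |y| = ∫⁻ y in Ioi (0 : ℝ), h |y| := by
    simpa using
      (Measure.measurePreserving_neg (volume : Measure ℝ)).setLIntegral_comp_preimage_emb
        (MeasurableEquiv.neg ℝ).measurableEmbedding (fun y => h |y|) (Ioi (0 : ℝ))
  rw [← lintegral_add_compl _ (measurableSet_Ioi (a := (0 : ℝ))), compl_Ioi,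
    ← setLIntegral_congr (Iio_ae_eq_Iic (a := (0 : ℝ))), hneg, hpos, two_mul]

lemma lintegral_gaussian {k : ℝ} (hk : 0 < k) (b : ℝ) :
    ∫⁻ y : ℝ, ENNReal.ofReal (Real.exp (-k * (y - b) ^ 2)) = ENNReal.ofReal √(Real.pi / k) := by
  rw [lintegral_sub_right_eq_self (fun y => ENNReal.ofReal (Real.exp (-k * y ^ 2))),
    ← integral_gaussian, ofReal_integral_eq_lintegral_ofReal (integrable_exp_neg_mul_sq hk)
      (Eventually.of_forall fun y => (Real.exp_pos _).le)]

lemma setLIntegral_Ioc_rpow {p R : ℝ} (hp : -1 < p) (hR : 0 ≤ R) :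
    ∫⁻ y in Ioc 0 R, ENNReal.ofReal (y ^ p) = ENNReal.ofReal (R ^ (p + 1) / (p + 1)) := by
  have hint : IntegrableOn (fun y : ℝ => y ^ p) (Ioc 0 R) := by
    rw [← intervalIntegrable_iff_integrableOn_Ioc_of_le hR]
    exact intervalIntegral.intervalIntegrable_rpow' hp
  rw [← ofReal_integral_eq_lintegral_ofReal hint
      (ae_restrict_of_forall_mem measurableSet_Ioc fun y hy => Real.rpow_nonneg hy.1.le p),
    ← intervalIntegral.integral_of_le hR, integral_rpow (Or.inl hp),
    Real.zero_rpow (by linarith), sub_zero]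

lemma exists_weightedGaussian_le_of_comparable (μ : ℝ) :
    ∃ C : ℝ, 0 < C ∧ ∀ s b y T : ℝ, 0 < s → 0 < T →
      s + b ^ 2 ≤ 3 * (1 + (y - b) ^ 2 / s) * T →
      T ≤ 3 * (1 + (y - b) ^ 2 / s) * (s + b ^ 2) → weightedGaussian μ s b y ≤
        C * (s ^ (-1 / 2 : ℝ) * T ^ (-μ) * Real.exp (-(1 / (4 * s)) * (y - b) ^ 2)) := by
  obtain ⟨C, hC, hpeetre⟩ := exists_rpow_le_exp_mul_rpow (-μ) (by norm_num : (0 : ℝ) < 1 / 4)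
  refine ⟨C, hC, fun s b y T hs hT hle hge => ?_⟩
  have hweight := hpeetre (s + b ^ 2) T ((y - b) ^ 2 / s) (by positivity) hT (by positivity) hle hge
  calc weightedGaussian μ s b y ≤ s ^ (-1 / 2 : ℝ) *
        (C * Real.exp (1 / 4 * ((y - b) ^ 2 / s)) * T ^ (-μ)) *
          Real.exp (-(y - b) ^ 2 / (2 * s)) := by unfold weightedGaussian; gcongr
    _ = C * (s ^ (-1 / 2 : ℝ) * T ^ (-μ) * (Real.exp (1 / 4 * ((y - b) ^ 2 / s)) *
          Real.exp (-(y - b) ^ 2 / (2 * s)))) := by ring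
    _ = _ := by
      rw [← Real.exp_add]
      congr 3
      field_simp
      ring

lemma exists_weightedGaussian_mul_rpow_le (μ : ℝ) :
    ∃ C : ℝ, 0 < C ∧ ∀ s b y : ℝ, 0 < s → 0 < y →
      (y ≤ √s → weightedGaussian μ s b y * y ^ (2 * μ) ≤
        C * s ^ (-1 / 2 - μ : ℝ) * y ^ (2 * μ)) ∧
      (√s < y → weightedGaussian μ s b y * y ^ (2 * μ) ≤
        C * s ^ (-1 / 2 : ℝ) * Real.exp (-(1 / (4 * s)) * (y - b) ^ 2)) := by
  obtain ⟨C, hC, hle⟩ := exists_weightedGaussian_le_of_comparable μ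
  refine ⟨C, hC, fun s b y hs hy => ?_⟩
  set Q := (y - b) ^ 2 / s with hQ
  have hQs : Q * s = (y - b) ^ 2 := by rw [hQ]; field_simp
  have hQ₀ : 0 ≤ Q := by positivity
  have hQb : 0 ≤ Q * b ^ 2 := by positivity
  refine ⟨fun hys => ?_, fun hys => ?_⟩
  · have hy2 : y ^ 2 ≤ s := (Real.le_sqrt' hy).1 hys
    have hexp : Real.exp (-(1 / (4 * s)) * (y - b) ^ 2) ≤ 1 := by
      rw [Real.exp_le_one_iff, neg_mul]
      exact neg_nonpos.2 (by positivity)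
    have hG := hle s b y s hs hs (by nlinarith [sq_nonneg (2 * y - b)]) (by nlinarith)
    gcongr
    calc _ ≤ _ := hG
      _ ≤ C * (s ^ (-1 / 2 : ℝ) * s ^ (-μ) * 1) := by gcongr
      _ = C * s ^ (-1 / 2 - μ : ℝ) := by rw [mul_one, ← Real.rpow_add hs, sub_eq_add_neg]
  · have hy2 : s ≤ y ^ 2 := ((Real.sqrt_lt' hy).1 hys).le
    have hG := hle s b y (y ^ 2) hs (by positivity)
      (by nlinarith [sq_nonneg (2 * y - b), mul_le_mul_of_nonneg_left hy2 hQ₀])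
      (by nlinarith [sq_nonneg (y - 2 * b)])
    have hcancel : (y ^ 2) ^ (-μ) * y ^ (2 * μ) = 1 := by
      rw [← Real.rpow_natCast, ← Real.rpow_mul hy.le, ← Real.rpow_add hy]
      norm_num
    calc _ ≤ C * (s ^ (-1 / 2 : ℝ) * (y ^ 2) ^ (-μ) *
          Real.exp (-(1 / (4 * s)) * (y - b) ^ 2)) * y ^ (2 * μ) := by gcongr
      _ = C * s ^ (-1 / 2 : ℝ) * Real.exp (-(1 / (4 * s)) * (y - b) ^ 2) *
          ((y ^ 2) ^ (-μ) * y ^ (2 * μ)) := by ring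
      _ = _ := by rw [hcancel, mul_one]

lemma lintegral_rpow_mul_gaussian_eq {s : ℝ} (hs : 0 < s) (b : ℝ) :
    ∫⁻ y : ℝ, ENNReal.ofReal (s ^ (-1 / 2 : ℝ) * Real.exp (-(1 / (4 * s)) * (y - b) ^ 2)) =
      ENNReal.ofReal √(4 * Real.pi) := by
  simp_rw [ENNReal.ofReal_mul (Real.rpow_nonneg hs.le _)]
  rw [lintegral_const_mul' _ _ ENNReal.ofReal_ne_top, lintegral_gaussian (by positivity),
    ← ENNReal.ofReal_mul (by positivity), show Real.pi / (1 / (4 * s)) = s * (4 * Real.pi) by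
      field_simp, Real.sqrt_mul hs.le, ← mul_assoc, Real.sqrt_eq_rpow s, ← Real.rpow_add hs]
  norm_num

lemma setLIntegral_Ioc_sqrt_rpow {μ s : ℝ} (hμ : -1 / 2 < μ) (hs : 0 < s) :
    ∫⁻ y in Ioc 0 √s, ENNReal.ofReal (s ^ (-1 / 2 - μ : ℝ) * y ^ (2 * μ)) =
      ENNReal.ofReal (1 / (2 * μ + 1)) := by
  simp_rw [ENNReal.ofReal_mul (Real.rpow_nonneg hs.le _)]
  rw [lintegral_const_mul' _ _ ENNReal.ofReal_ne_top,
    setLIntegral_Ioc_rpow (by linarith) (Real.sqrt_nonneg s), ← ENNReal.ofReal_mul (by positivity),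
    Real.sqrt_eq_rpow, ← Real.rpow_mul hs.le, ← mul_div_assoc, ← Real.rpow_add hs,
    show -1 / 2 - μ + 1 / 2 * (2 * μ + 1) = 0 by ring, Real.rpow_zero]

lemma exists_lintegral_weightedGaussian_le {μ : ℝ} (hμ : -1 / 2 < μ) :
    ∃ C : ℝ, 0 < C ∧ ∀ s b : ℝ, 0 < s →
      ∫⁻ y : ℝ, ENNReal.ofReal (weightedGaussian μ s b |y| * |y| ^ (2 * μ)) ≤
        ENNReal.ofReal C := by
  obtain ⟨C, hC, hle⟩ := exists_weightedGaussian_mul_rpow_le μ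
  have hμ' : 0 < 2 * μ + 1 := by linarith
  refine ⟨2 * (C * (1 / (2 * μ + 1)) + C * √(4 * Real.pi)), by positivity, fun s b hs => ?_⟩
  have hnear : ∫⁻ y in Ioc 0 √s, ENNReal.ofReal (weightedGaussian μ s b y * y ^ (2 * μ)) ≤
      ENNReal.ofReal (C * (1 / (2 * μ + 1))) := by
    rw [ENNReal.ofReal_mul hC.le, ← setLIntegral_Ioc_sqrt_rpow hμ hs,
      ← lintegral_const_mul' _ _ ENNReal.ofReal_ne_top]
    refine setLIntegral_mono' measurableSet_Ioc fun y hy => ?_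
    rw [← ENNReal.ofReal_mul hC.le, ← mul_assoc]
    exact ENNReal.ofReal_le_ofReal ((hle s b y hs hy.1).1 hy.2)
  have hfar : ∫⁻ y in Ioi √s, ENNReal.ofReal (weightedGaussian μ s b y * y ^ (2 * μ)) ≤
      ENNReal.ofReal (C * √(4 * Real.pi)) := by
    rw [ENNReal.ofReal_mul hC.le, ← lintegral_rpow_mul_gaussian_eq hs b,
      ← lintegral_const_mul' _ _ ENNReal.ofReal_ne_top]
    refine (setLIntegral_mono' measurableSet_Ioi fun y hy => ?_).trans
      (setLIntegral_le_lintegral (Ioi √s) _)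
    rw [← ENNReal.ofReal_mul hC.le, ← mul_assoc]
    exact ENNReal.ofReal_le_ofReal ((hle s b y hs ((Real.sqrt_nonneg s).trans_lt hy)).2 hy)
  rw [lintegral_comp_abs fun y => ENNReal.ofReal (weightedGaussian μ s b y * y ^ (2 * μ)),
    ENNReal.ofReal_mul zero_le_two, ENNReal.ofReal_ofNat,
    ENNReal.ofReal_add (by positivity) (by positivity), ← Ioc_union_Ioi_eq_Ioi (Real.sqrt_nonneg s),
    lintegral_union measurableSet_Ioi (Ioc_disjoint_Ioi le_rfl)]
  gcongr

/-! ### The unimodal majorant of the kernel -/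

lemma isFiniteMeasure_lam {μ : ℝ} (hμ : -1 / 2 < μ) : IsFiniteMeasure (lam μ) := by
  have hint := integrableOn_rpow_mul_exp_neg_mul_sq one_pos (by linarith : -1 < 2 * μ)
  have hcomp := lintegral_comp_abs fun y => ENNReal.ofReal (y ^ (2 * μ) * Real.exp (-1 * y ^ 2))
  simp only [sq_abs, neg_one_mul] at hcomp hint
  refine isFiniteMeasure_withDensity ?_
  rw [hcomp]
  exact ENNReal.mul_ne_top ENNReal.ofNat_ne_top hint.lintegral_lt_top.ne

lemma lintegral_ofReal_lam (μ : ℝ) {g : ℝ → ℝ} (hg : Measurable g) :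
    ∫⁻ y, ENNReal.ofReal (g y) ∂(lam μ) =
      ∫⁻ y, ENNReal.ofReal (Real.exp (-y ^ 2) * g y * |y| ^ (2 * μ)) := by
  rw [lam, lintegral_withDensity_eq_lintegral_mul _ (by fun_prop) (by fun_prop)]
  refine lintegral_congr fun y => ?_
  rw [Pi.mul_apply, ← ENNReal.ofReal_mul (by positivity)]
  ring_nf

/-- `F` is monotone on the way towards `x` and antitone on the way from `x`. -/
def UnimodalAt {α β : Type*} [Lattice α] [LE β] (F : α → β) (x : α) : Prop :=
  ∀ y, ∀ z ∈ uIcc x y, F y ≤ F z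

lemma UnimodalAt.add {α β : Type*} [Lattice α] [Add β] [Preorder β] [AddLeftMono β]
    [AddRightMono β] {F G : α → β} {x : α} (hF : UnimodalAt F x) (hG : UnimodalAt G x) :
    UnimodalAt (F + G) x :=
  fun y z hz => add_le_add (hF y z hz) (hG y z hz)

lemma UnimodalAt.ordConnected_setOf_lt {α β : Type*} [LinearOrder α] [Preorder β] {F : α → β}
    {x : α} (hF : UnimodalAt F x) (t : β) : {y | t < F y}.OrdConnected :=
  ⟨fun y hy z hz w hw => by
    rcases le_total x w with hxw | hwx
    · exact lt_of_lt_of_le hz (hF z w (Icc_subset_uIcc ⟨hxw, hw.2⟩))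
    · exact lt_of_lt_of_le hy (hF y w (Icc_subset_uIcc' ⟨hw.1, hwx⟩))⟩

section Indicator

variable {α β : Type*} [LinearOrder α] [Zero β] [Preorder β] {F : α → β} {a x : α}

lemma unimodalAt_indicator_Icc (hF : MonotoneOn F (Icc a x))
    (hF₀ : ∀ y ∈ Icc a x, 0 ≤ F y) : UnimodalAt ((Icc a x).indicator F) x := fun y z hz => by
  by_cases hy : y ∈ Icc a x
  · rw [uIcc_of_ge hy.2] at hz
    have hz' : z ∈ Icc a x := ⟨hy.1.trans hz.1, hz.2⟩
    rw [indicator_of_mem hy, indicator_of_mem hz']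
    exact hF hy hz' hz.1
  · rw [indicator_of_notMem hy]
    exact indicator_nonneg hF₀ z

lemma unimodalAt_indicator_Ici (hF : AntitoneOn F (Ici x))
    (hF₀ : ∀ y ∈ Ici x, 0 ≤ F y) : UnimodalAt ((Ici x).indicator F) x := fun y z hz => by
  by_cases hy : y ∈ Ici x
  · rw [uIcc_of_le hy] at hz
    rw [indicator_of_mem hy, indicator_of_mem (show z ∈ Ici x from hz.1)]
    exact hF hz.1 hy hz.2
  · rw [indicator_of_notMem hy]
    exact indicator_nonneg hF₀ z

end Indicator

noncomputable section

/-- Up to a constant factor, a majorant of `|kernel μ r x y|` as a function of `y = |y|` for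
`X = |x|`. The kernel itself peaks near `X / r`; beyond `X` its bound is flattened up to the peak,
so that the majorant is unimodal at `X`. -/
def kernelMajorant (μ r X : ℝ) : ℝ → ℝ :=
  (Icc 0 X).indicator (fun y => Real.exp (y ^ 2) * weightedGaussian μ (1 - r ^ 2) (r * X) y) +
    (Ici X).indicator
      (fun y => Real.exp (X ^ 2) * weightedGaussian μ (1 - r ^ 2) X (max (r * y) X))

end

lemma weightedGaussian_le_of_abs_le (μ : ℝ) {s b y z : ℝ} (hs : 0 < s)
    (hzy : |z - b| ≤ |y - b|) : weightedGaussian μ s b y ≤ weightedGaussian μ s b z := by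
  unfold weightedGaussian
  gcongr _ * Real.exp (-?_ / _)
  exact sq_le_sq.2 hzy

lemma measurable_kernelMajorant (μ r X : ℝ) : Measurable (kernelMajorant μ r X) := by
  have hG := measurable_weightedGaussian μ (1 - r ^ 2)
  refine .add (.indicator (.mul (by fun_prop) (hG _)) measurableSet_Icc)
    (.indicator (.mul (by fun_prop) ((hG _).comp (by fun_prop))) measurableSet_Ici)

section KernelMajorant

variable {r : ℝ} (hr₀ : 0 < r) (hr₁ : r < 1)
include hr₀ hr₁

lemma one_sub_sq_pos : 0 < 1 - r ^ 2 := by nlinarith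

lemma kernelMajorant_nonneg (μ X y : ℝ) : 0 ≤ kernelMajorant μ r X y := by
  have hG (b z : ℝ) := weightedGaussian_nonneg μ b z (one_sub_sq_pos hr₀ hr₁)
  exact add_nonneg (indicator_nonneg (fun z _ => mul_nonneg (Real.exp_pos _).le (hG _ _)) y)
    (indicator_nonneg (fun z _ => mul_nonneg (Real.exp_pos _).le (hG _ _)) y)

lemma monotoneOn_exp_sq_mul_weightedGaussian (μ X : ℝ) :
    MonotoneOn (fun y => Real.exp (y ^ 2) * weightedGaussian μ (1 - r ^ 2) (r * X) y)
      (Icc 0 X) := by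
  rintro y ⟨hy, -⟩ z ⟨-, hzX⟩ hyz
  have hs := one_sub_sq_pos hr₀ hr₁
  have hexp : y ^ 2 + -(y - r * X) ^ 2 / (2 * (1 - r ^ 2)) ≤
      z ^ 2 + -(z - r * X) ^ 2 / (2 * (1 - r ^ 2)) := by
    rw [← sub_nonneg]
    calc 0 ≤ (z - y) * ((z + y) * ((1 - r) * (1 + 2 * r)) + r * (2 * X - (z + y))) /
          (2 * (1 - r ^ 2)) := by
          have hfst : 0 ≤ (z + y) * ((1 - r) * (1 + 2 * r)) :=
            mul_nonneg (by linarith) (mul_nonneg (by linarith) (by linarith))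
          have hsnd : 0 ≤ r * (2 * X - (z + y)) := mul_nonneg hr₀.le (by linarith)
          exact div_nonneg (mul_nonneg (by linarith) (by linarith)) (by linarith)
      _ = _ := by field_simp; ring
  have hcomm (w : ℝ) : Real.exp (w ^ 2) * weightedGaussian μ (1 - r ^ 2) (r * X) w =
      (1 - r ^ 2) ^ (-1 / 2 : ℝ) * (1 - r ^ 2 + (r * X) ^ 2) ^ (-μ) *
        Real.exp (w ^ 2 + -(w - r * X) ^ 2 / (2 * (1 - r ^ 2))) := by
    rw [weightedGaussian, Real.exp_add]; ring
  simp only [hcomm]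
  gcongr

lemma antitoneOn_exp_sq_mul_weightedGaussian (μ X : ℝ) :
    AntitoneOn (fun y => Real.exp (X ^ 2) * weightedGaussian μ (1 - r ^ 2) X (max (r * y) X))
      (Ici X) := by
  intro y _ z _ hyz
  refine mul_le_mul_of_nonneg_left ?_ (Real.exp_pos _).le
  refine weightedGaussian_le_of_abs_le μ (one_sub_sq_pos hr₀ hr₁) (abs_le_abs_of_nonneg ?_ ?_)
  · exact sub_nonneg.2 (le_max_right _ _)
  · gcongr

lemma unimodalAt_kernelMajorant (μ X : ℝ) : UnimodalAt (kernelMajorant μ r X) X := by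
  have hG (b z : ℝ) := weightedGaussian_nonneg μ b z (one_sub_sq_pos hr₀ hr₁)
  exact .add
    (unimodalAt_indicator_Icc (monotoneOn_exp_sq_mul_weightedGaussian hr₀ hr₁ μ X)
      fun y _ => mul_nonneg (Real.exp_pos _).le (hG _ _))
    (unimodalAt_indicator_Ici (antitoneOn_exp_sq_mul_weightedGaussian hr₀ hr₁ μ X)
      fun y _ => mul_nonneg (Real.exp_pos _).le (hG _ _))

lemma le_kernelMajorant_of_le (μ : ℝ) {X y : ℝ} (hy : 0 ≤ y) (hyX : y ≤ X) :
    Real.exp (y ^ 2) * weightedGaussian μ (1 - r ^ 2) (r * X) y ≤ kernelMajorant μ r X y := by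
  have hG := weightedGaussian_nonneg μ X (y := max (r * y) X) (one_sub_sq_pos hr₀ hr₁)
  rw [kernelMajorant, Pi.add_apply, indicator_of_mem (show y ∈ Icc 0 X from ⟨hy, hyX⟩)]
  exact le_add_of_nonneg_right (indicator_apply_nonneg fun _ => by positivity)

lemma le_kernelMajorant_of_ge (μ : ℝ) {X y : ℝ} (hXy : X ≤ y) :
    Real.exp (X ^ 2) * weightedGaussian μ (1 - r ^ 2) X (r * y) ≤ kernelMajorant μ r X y := by
  have hs := one_sub_sq_pos hr₀ hr₁
  have hG := weightedGaussian_nonneg μ (r * X) (y := y) hs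
  have hmax : |max (r * y) X - X| ≤ |r * y - X| := by
    rw [← max_sub_sub_right, sub_self, abs_of_nonneg (le_max_right _ _)]
    exact max_le (le_abs_self _) (abs_nonneg _)
  rw [kernelMajorant, Pi.add_apply, indicator_of_mem (show y ∈ Ici X from hXy)]
  refine le_add_of_nonneg_of_le (indicator_apply_nonneg fun _ => by positivity) ?_
  gcongr
  exact weightedGaussian_le_of_abs_le μ hs hmax

/-- Beyond `X` the Gaussian weight makes up for the flattening of the majorant up to `X / r`. -/
lemma exp_sq_sub_sq_mul_weightedGaussian_le (μ : ℝ) {X y : ℝ} (hX : 0 ≤ X) (hXy : X ≤ y) :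
    Real.exp (X ^ 2 - y ^ 2) * weightedGaussian μ (1 - r ^ 2) X (max (r * y) X) ≤
      weightedGaussian μ (1 - r ^ 2) X y := by
  have hs := one_sub_sq_pos hr₀ hr₁
  set m := max (r * y) X - X with hm
  have hm₀ : 0 ≤ m := sub_nonneg.2 (le_max_right _ _)
  have hry : r * y ≤ X + m := by rw [hm, add_sub_cancel]; exact le_max_left _ _
  have hdist : y - X ≤ (1 - r ^ 2) * y + m := by nlinarith
  have hexp : X ^ 2 - y ^ 2 + -m ^ 2 / (2 * (1 - r ^ 2)) ≤ -(y - X) ^ 2 / (2 * (1 - r ^ 2)) := by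
    rw [← sub_nonneg]
    calc 0 ≤ (2 * (1 - r ^ 2) * (y ^ 2 - X ^ 2) + m ^ 2 - (y - X) ^ 2) / (2 * (1 - r ^ 2)) := by
          refine div_nonneg ?_ (by linarith)
          nlinarith [mul_le_mul_of_nonneg_left hdist (sub_nonneg.2 hXy), sq_nonneg (y - X - m),
            mul_nonneg hs.le (mul_nonneg hX (sub_nonneg.2 hXy))]
      _ = _ := by field_simp; ring
  calc _ = (1 - r ^ 2) ^ (-1 / 2 : ℝ) * (1 - r ^ 2 + X ^ 2) ^ (-μ) *
        Real.exp (X ^ 2 - y ^ 2 + -m ^ 2 / (2 * (1 - r ^ 2))) := by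
        rw [weightedGaussian, Real.exp_add]; ring
    _ ≤ _ := by unfold weightedGaussian; gcongr

lemma exp_neg_sq_mul_kernelMajorant_le (μ : ℝ) {X : ℝ} (hX : 0 ≤ X) (y : ℝ) :
    Real.exp (-y ^ 2) * kernelMajorant μ r X y ≤
      weightedGaussian μ (1 - r ^ 2) (r * X) y + weightedGaussian μ (1 - r ^ 2) X y := by
  have hs := one_sub_sq_pos hr₀ hr₁
  rw [kernelMajorant, Pi.add_apply, mul_add,
    ← indicator_mul_right _ fun y => Real.exp (-y ^ 2),
    ← indicator_mul_right _ fun y => Real.exp (-y ^ 2)]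
  refine add_le_add (indicator_apply_le' (fun _ => ?_) fun _ => weightedGaussian_nonneg _ _ _ hs)
    (indicator_apply_le' (fun hy => ?_) fun _ => weightedGaussian_nonneg _ _ _ hs)
  · rw [← mul_assoc, ← Real.exp_add, neg_add_cancel, Real.exp_zero, one_mul]
  · rw [← mul_assoc, ← Real.exp_add, neg_add_eq_sub]
    exact exp_sq_sub_sq_mul_weightedGaussian_le hr₀ hr₁ μ hX hy

end KernelMajorant

lemma exists_abs_kernel_le_kernelMajorant {μ : ℝ} (hμ : -1 / 2 < μ) :
    ∃ C : ℝ, 0 < C ∧ ∀ r x y : ℝ, 0 < r → r < 1 →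
      |kernel μ r x y| ≤ C * kernelMajorant μ r |x| |y| := by
  obtain ⟨C, hC, hle⟩ := exists_abs_kernel_le_weightedGaussian hμ
  refine ⟨C, hC, fun r x y hr₀ hr₁ => ?_⟩
  have hs := one_sub_sq_pos hr₀ hr₁
  rcases le_total |y| |x| with hyx | hxy
  · refine (hle r _ (r * |x|) |y| x y hr₀ hs rfl (by positivity) (abs_nonneg y) rfl).trans ?_
    gcongr
    refine le_of_eq_of_le ?_ (le_kernelMajorant_of_le hr₀ hr₁ μ (abs_nonneg y) hyx)
    congr 2
    rw [← sq_abs x, ← sq_abs y]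
    field_simp
    ring
  · refine (hle r _ |x| (r * |y|) x y hr₀ hs rfl (abs_nonneg x) (by positivity) (by ring)).trans ?_
    gcongr
    refine le_of_eq_of_le ?_ (le_kernelMajorant_of_ge hr₀ hr₁ μ hxy)
    congr 2
    rw [← sq_abs x, ← sq_abs y]
    field_simp
    ring

lemma exists_lintegral_kernelMajorant_le {μ : ℝ} (hμ : -1 / 2 < μ) :
    ∃ C : ℝ, 0 < C ∧ ∀ r X : ℝ, 0 < r → r < 1 → 0 ≤ X →
      ∫⁻ y, ENNReal.ofReal (kernelMajorant μ r X |y|) ∂(lam μ) ≤ ENNReal.ofReal C := by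
  obtain ⟨C, hC, hle⟩ := exists_lintegral_weightedGaussian_le hμ
  refine ⟨C + C, by positivity, fun r X hr₀ hr₁ hX => ?_⟩
  have hs := one_sub_sq_pos hr₀ hr₁
  have habs : Measurable fun y : ℝ => |y| := by fun_prop
  have hG (b y : ℝ) : 0 ≤ weightedGaussian μ (1 - r ^ 2) b |y| * |y| ^ (2 * μ) :=
    mul_nonneg (weightedGaussian_nonneg _ _ _ hs) (by positivity)
  have hGm : Measurable fun y : ℝ =>
      ENNReal.ofReal (weightedGaussian μ (1 - r ^ 2) (r * X) |y| * |y| ^ (2 * μ)) :=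
    (((measurable_weightedGaussian _ _ _).comp habs).mul (by fun_prop)).ennreal_ofReal
  rw [lintegral_ofReal_lam μ (g := fun y => kernelMajorant μ r X |y|)
    ((measurable_kernelMajorant μ r X).comp habs)]
  calc _ ≤ ∫⁻ y, (ENNReal.ofReal (weightedGaussian μ (1 - r ^ 2) (r * X) |y| * |y| ^ (2 * μ)) +
        ENNReal.ofReal (weightedGaussian μ (1 - r ^ 2) X |y| * |y| ^ (2 * μ))) := by
        refine lintegral_mono fun y => ?_
        rw [← ENNReal.ofReal_add (hG _ y) (hG _ y), ← add_mul]
        refine ENNReal.ofReal_le_ofReal (mul_le_mul_of_nonneg_right ?_ (by positivity))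
        rw [← sq_abs]
        exact exp_neg_sq_mul_kernelMajorant_le hr₀ hr₁ μ hX |y|
    _ ≤ ENNReal.ofReal (C + C) := by
        rw [lintegral_add_left hGm, ENNReal.ofReal_add hC.le hC.le]
        gcongr <;> exact hle _ _ hs

/-! ### The uncentred maximal function of a measure -/

section OrdConnected

variable {α : Type*} [LinearOrder α]

lemma exists_inter_Ici_subset {t : Finset (Set α)} (ht₀ : t.Nonempty) {x : α}
    (ht : ∀ I ∈ t, I.OrdConnected) (hx : ∀ I ∈ t, x ∈ I) : ∃ J ∈ t, ∀ I ∈ t, I ∩ Ici x ⊆ J := by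
  obtain ⟨J, hJt, hJ⟩ := t.exists_maximalFor (fun I => I ∩ Ici x) ht₀
  refine ⟨J, hJt, fun I hI => ?_⟩
  by_contra hIJ
  obtain ⟨y, ⟨hyI, hxy⟩, hyJ⟩ := not_subset.1 hIJ
  have hJI : J ∩ Ici x ⊆ I ∩ Ici x := fun z ⟨hzJ, hxz⟩ =>
    ⟨(ht I hI).out (hx I hI) hyI ⟨hxz, le_of_not_ge fun hyz =>
      hyJ ((ht J hJt).out (hx J hJt) hzJ ⟨hxy, hyz⟩)⟩, hxz⟩
  exact hyJ (hJ hI hJI ⟨hyI, hxy⟩).1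

lemma exists_subset_union_of_ordConnected {t : Finset (Set α)} (ht₀ : t.Nonempty) {x : α}
    (ht : ∀ I ∈ t, I.OrdConnected) (hx : ∀ I ∈ t, x ∈ I) :
    ∃ J ∈ t, ∃ K ∈ t, ∀ I ∈ t, I ⊆ J ∪ K := by
  obtain ⟨J, hJt, hJ⟩ := exists_inter_Ici_subset ht₀ ht hx
  obtain ⟨K, hKt, hK⟩ := exists_inter_Ici_subset (α := αᵒᵈ) ht₀ (fun I hI => (ht I hI).dual) hx
  refine ⟨J, hJt, K, hKt, fun I hI y hy => ?_⟩
  rcases le_total x y with hxy | hyx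
  · exact .inl (hJ I hI ⟨hy, hxy⟩)
  · exact .inr (hK I hI ⟨hy, hyx⟩)

open Classical in
lemma exists_subfamily_card_filter_mem_le_two (t : Finset (Set α))
    (ht : ∀ I ∈ t, I.OrdConnected) :
    ∃ u ⊆ t, (⋃ I ∈ u, I) = ⋃ I ∈ t, I ∧ ∀ x, #{I ∈ u | x ∈ I} ≤ 2 := by
  obtain ⟨u, hut, ⟨hu, hmin⟩⟩ := exists_minimal_le_of_wellFoundedLT
    (fun u : Finset (Set α) => (⋃ I ∈ t, I) ⊆ ⋃ I ∈ u, I) t subset_rfl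
  refine ⟨u, hut, (biUnion_subset_biUnion_left hut).antisymm hu, fun x => ?_⟩
  rcases Finset.eq_empty_or_nonempty {I ∈ u | x ∈ I} with hempty | hne
  · simp only [hempty, Finset.card_empty, zero_le]
  obtain ⟨J, hJ, K, hK, hJK⟩ := exists_subset_union_of_ordConnected hne
    (fun I hI => ht I (hut (Finset.mem_filter.1 hI).1)) fun I hI => (Finset.mem_filter.1 hI).2
  refine (Finset.card_le_card fun I hI => ?_).trans (Finset.card_le_two (a := J) (b := K))
  by_contra hIJK
  simp only [Finset.mem_insert, Finset.mem_singleton, not_or] at hIJK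
  have hcover : (⋃ I' ∈ u, I') ⊆ ⋃ I' ∈ u.erase I, I' := iUnion₂_subset fun I' hI' => by
    rcases eq_or_ne I' I with rfl | hne
    · refine (hJK I' hI).trans (union_subset ?_ ?_)
      · exact subset_biUnion_of_mem (u := id)
          (Finset.mem_erase.2 ⟨Ne.symm hIJK.1, (Finset.mem_filter.1 hJ).1⟩)
      · exact subset_biUnion_of_mem (u := id)
          (Finset.mem_erase.2 ⟨Ne.symm hIJK.2, (Finset.mem_filter.1 hK).1⟩)
    · exact subset_biUnion_of_mem (u := id) (Finset.mem_erase.2 ⟨hne, hI'⟩)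
  exact Finset.notMem_erase I u
    (hmin (hu.trans hcover) (Finset.erase_subset I u) (Finset.mem_filter.1 hI).1)

lemma isOpen_ordConnectedComponent [TopologicalSpace α] [OrderTopology α] {s : Set α}
    (hs : IsOpen s) (x : α) : IsOpen (ordConnectedComponent s x) :=
  isOpen_iff_mem_nhds.2 fun y hy => by
    rw [ordConnectedComponent_eq (mem_ordConnectedComponent.1 hy)]
    exact ordConnectedComponent_mem_nhds.2 (hs.mem_nhds (ordConnectedComponent_subset hy))

end OrdConnected

open Classical in
lemma sum_measure_le_mul_measure_univ {α : Type*} [MeasurableSpace α] (ρ : Measure α)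
    {u : Finset (Set α)} (hu : ∀ I ∈ u, MeasurableSet I) {n : ℕ} (hn : ∀ x, #{I ∈ u | x ∈ I} ≤ n) :
    ∑ I ∈ u, ρ I ≤ n * ρ univ :=
  calc ∑ I ∈ u, ρ I = ∫⁻ x, ∑ I ∈ u, I.indicator 1 x ∂ρ := by
        rw [lintegral_finsetSum _ fun I hI => measurable_one.indicator (hu I hI)]
        exact Finset.sum_congr rfl fun I hI => (lintegral_indicator_one (hu I hI)).symm
    _ ≤ ∫⁻ _, n ∂ρ := by
        refine lintegral_mono fun x => ?_
        simp only [indicator_apply, Pi.one_apply, Finset.sum_boole]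
        exact_mod_cast hn x
    _ = n * ρ univ := lintegral_const _

section UncenteredMaximal

variable {α : Type*} [LinearOrder α] [MeasurableSpace α]

/-- The uncentred maximal function of the measure `ρ` with respect to `ν`: the supremum of
`ρ I / ν I` over the order-connected sets `I ∋ x`. By the conventions of `ℝ≥0∞`, sets with
`ρ I = ν I = 0` or `ν I = ∞` contribute `0`, and sets with `ν I = 0 < ρ I` contribute `∞`. -/
noncomputable def uncenteredMaximal (ν ρ : Measure α) (x : α) : ℝ≥0∞ :=
  ⨆ (I : Set α) (_ : I.OrdConnected) (_ : x ∈ I), ρ I / ν I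

lemma measure_le_uncenteredMaximal_mul (ν ρ : Measure α) [IsFiniteMeasure ν] {I : Set α}
    (hI : I.OrdConnected) {x : α} (hx : x ∈ I) (htop : uncenteredMaximal ν ρ x ≠ ∞) :
    ρ I ≤ uncenteredMaximal ν ρ x * ν I := by
  rw [← ENNReal.div_le_iff_le_mul (.inr htop) (.inl (measure_ne_top ν I))]
  exact le_iSup₂_of_le I hI (le_iSup_of_le hx le_rfl)

lemma uncenteredMaximal_le_of_le_smul {ν ρ : Measure α} {c : ℝ≥0∞} (h : ρ ≤ c • ν) (x : α) :
    uncenteredMaximal ν ρ x ≤ c :=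
  iSup₂_le fun I _ => iSup_le fun _ => ENNReal.div_le_of_le_mul (h I)

lemma exists_isOpen_ordConnected_of_lt_uncenteredMaximal [TopologicalSpace α] [OrderTopology α]
    (ν ρ : Measure α) [ν.OuterRegular] {η : ℝ≥0∞} (hη₀ : η ≠ 0) (hη : η ≠ ∞) {x : α}
    (hx : η < uncenteredMaximal ν ρ x) :
    ∃ V, IsOpen V ∧ V.OrdConnected ∧ x ∈ V ∧ η * ν V ≤ ρ V := by
  simp only [uncenteredMaximal, lt_iSup_iff] at hx
  obtain ⟨I, hI, hxI, hlt⟩ := hx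
  have hνI : ν I < ρ I / η := by
    rw [ENNReal.lt_div_iff_mul_lt (.inl hη₀) (.inl hη), mul_comm]
    exact ENNReal.mul_lt_of_lt_div hlt
  obtain ⟨U, hIU, hU, hνU⟩ := I.exists_isOpen_lt_of_lt _ hνI
  have hIV : I ⊆ ordConnectedComponent U x := subset_ordConnectedComponent hxI hIU
  refine ⟨ordConnectedComponent U x, isOpen_ordConnectedComponent hU x, inferInstance, hIV hxI, ?_⟩
  calc η * ν (ordConnectedComponent U x) ≤ η * ν U := by
        gcongr
        exact ordConnectedComponent_subset
    _ ≤ ρ I := by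
        rw [mul_comm]
        exact ENNReal.mul_le_of_le_div hνU.le
    _ ≤ ρ (ordConnectedComponent U x) := measure_mono hIV

lemma mul_measure_compact_le [TopologicalSpace α] [OpensMeasurableSpace α] (ν ρ : Measure α)
    {η : ℝ≥0∞} {K : Set α} (hK : IsCompact K)
    (hV : ∀ x ∈ K, ∃ V, IsOpen V ∧ V.OrdConnected ∧ x ∈ V ∧ η * ν V ≤ ρ V) :
    η * ν K ≤ 2 * ρ univ := by
  choose! V hVo hVc hxV hηV using hV
  obtain ⟨T, hTK, hT⟩ := hK.elim_nhds_subcover V fun x hx => (hVo x hx).mem_nhds (hxV x hx)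
  classical
  obtain ⟨u, huT, hu, hcard⟩ := exists_subfamily_card_filter_mem_le_two (T.image V)
    (Finset.forall_mem_image.2 fun x hx => hVc x (hTK x hx))
  have hprop (I) (hI : I ∈ u) : IsOpen I ∧ η * ν I ≤ ρ I := by
    obtain ⟨x, hx, rfl⟩ := Finset.mem_image.1 (huT hI)
    exact ⟨hVo x (hTK x hx), hηV x (hTK x hx)⟩
  have hKu : K ⊆ ⋃ I ∈ u, I := by
    rw [hu, Finset.set_biUnion_finset_image]
    exact hT
  calc η * ν K ≤ η * ∑ I ∈ u, ν I := by
        gcongr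
        exact (measure_mono hKu).trans (measure_biUnion_finset_le u id)
    _ = ∑ I ∈ u, η * ν I := Finset.mul_sum _ _ _
    _ ≤ ∑ I ∈ u, ρ I := Finset.sum_le_sum fun I hI => (hprop I hI).2
    _ ≤ 2 * ρ univ :=
        sum_measure_le_mul_measure_univ ρ (fun I hI => (hprop I hI).1.measurableSet) hcard

lemma mul_measure_lt_uncenteredMaximal_le [TopologicalSpace α] [OrderTopology α]
    [OpensMeasurableSpace α] (ν ρ : Measure α) [ν.Regular] (η : ℝ≥0∞) :
    η * ν {x | η < uncenteredMaximal ν ρ x} ≤ 2 * ρ univ := by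
  rcases eq_or_ne η 0 with rfl | hη₀
  · rw [zero_mul]
    exact zero_le
  rcases eq_or_ne η ∞ with rfl | hη
  · simp only [not_top_lt, ofPred_false, measure_empty, mul_zero, zero_le]
  set U := ⋃₀ {V | IsOpen V ∧ V.OrdConnected ∧ η * ν V ≤ ρ V}
  have hsub : {x | η < uncenteredMaximal ν ρ x} ⊆ U := fun x hx => by
    obtain ⟨V, hVo, hVc, hxV, hV⟩ :=
      exists_isOpen_ordConnected_of_lt_uncenteredMaximal ν ρ hη₀ hη hx
    exact ⟨V, ⟨hVo, hVc, hV⟩, hxV⟩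
  have hUo : IsOpen U := isOpen_sUnion fun V hV => hV.1
  refine (mul_le_mul_right (measure_mono hsub) η).trans ?_
  simp_rw [hUo.measure_eq_iSup_isCompact, ENNReal.mul_iSup]
  refine iSup₂_le fun K hKU => iSup_le fun hK => mul_measure_compact_le ν ρ hK fun x hx => ?_
  obtain ⟨V, ⟨hVo, hVc, hV⟩, hxV⟩ := hKU hx
  exact ⟨V, hVo, hVc, hxV, hV⟩

lemma UnimodalAt.lintegral_le_uncenteredMaximal_mul {ν ρ : Measure α} [IsFiniteMeasure ν]
    {F : α → ℝ} {x : α} (hF : UnimodalAt F x) (hFm : Measurable F) (hF₀ : 0 ≤ F)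
    (htop : uncenteredMaximal ν ρ x ≠ ∞) :
    ∫⁻ y, ENNReal.ofReal (F y) ∂ρ ≤
      uncenteredMaximal ν ρ x * ∫⁻ y, ENNReal.ofReal (F y) ∂ν := by
  rw [lintegral_eq_lintegral_meas_lt ρ (.of_forall hF₀) hFm.aemeasurable,
    lintegral_eq_lintegral_meas_lt ν (.of_forall hF₀) hFm.aemeasurable,
    ← lintegral_const_mul' _ _ htop]
  refine lintegral_mono fun t => ?_
  rcases eq_empty_or_nonempty {y | t < F y} with hempty | ⟨y, hy⟩
  · simp only [hempty, measure_empty, zero_le]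
  · exact measure_le_uncenteredMaximal_mul ν ρ (hF.ordConnected_setOf_lt t)
      (lt_of_lt_of_le hy (hF y x left_mem_uIcc)) htop

end UncenteredMaximal

/-! ### The maximal function of the semigroup -/

lemma continuous_kernel {μ : ℝ} (hμ : -1 / 2 < μ) (r : ℝ) :
    Continuous fun p : ℝ × ℝ => kernel μ r p.1 p.2 := by
  have := continuous_genExp hμ
  unfold kernel
  fun_prop

lemma exists_continuous_abs_kernel_le {μ : ℝ} (hμ : -1 / 2 < μ) {r : ℝ} (hr₀ : 0 < r)
    (hr₁ : r < 1) : ∃ B : ℝ → ℝ, Continuous B ∧ ∀ x y, |kernel μ r x y| ≤ B x := by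
  obtain ⟨C, hC, hle⟩ := exists_abs_kernel_le_weightedGaussian hμ
  have hs := one_sub_sq_pos hr₀ hr₁
  refine ⟨fun x => C * (Real.exp (x ^ 2) * ((1 - r ^ 2) ^ (-1 / 2 : ℝ) *
    (1 - r ^ 2 + x ^ 2) ^ (-μ))), ?_, fun x y => ?_⟩
  · have : Continuous fun x : ℝ => (1 - r ^ 2 + x ^ 2) ^ (-μ) :=
      .rpow_const (by fun_prop) fun x => .inl (by positivity)
    fun_prop
  · have hexp : (|x| ^ 2 + (r * |y|) ^ 2 - (x ^ 2 + y ^ 2) * r ^ 2) / (1 - r ^ 2) = x ^ 2 := by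
      rw [mul_pow, sq_abs, sq_abs]
      field_simp
      ring
    refine (hle r _ |x| (r * |y|) x y hr₀ hs rfl (abs_nonneg x) (by positivity) (by ring)).trans ?_
    rw [hexp, weightedGaussian, sq_abs]
    change _ ≤ C * (Real.exp (x ^ 2) * _)
    gcongr C * (_ * ?_)
    refine mul_le_of_le_one_right (by positivity) (Real.exp_le_one_iff.2 ?_)
    exact div_nonpos_of_nonpos_of_nonneg (neg_nonpos.2 (sq_nonneg _)) (by positivity)

lemma integrable_kernel_smul {E : Type*} [NormedAddCommGroup E] [NormedSpace ℝ E] {μ : ℝ}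
    (hμ : -1 / 2 < μ) {r : ℝ} (hr₀ : 0 < r) (hr₁ : r < 1) {f : ℝ → E}
    (hf : Integrable f (lam μ)) (x : ℝ) :
    Integrable (fun y => kernel μ r x y • f y) (lam μ) := by
  obtain ⟨B, -, hB⟩ := exists_continuous_abs_kernel_le hμ hr₀ hr₁
  have hK : Continuous fun y => kernel μ r x y := (continuous_kernel hμ r).comp (.prodMk_right x)
  exact hf.bdd_smul (B x) hK.aestronglyMeasurable (.of_forall (hB x))

section Maximal

variable {𝕜 : Type*} [RCLike 𝕜]

lemma continuous_semigroup {μ : ℝ} (hμ : -1 / 2 < μ) {t : ℝ} (ht : 0 < t) {f : ℝ → 𝕜}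
    (hf : Integrable f (lam μ)) : Continuous (semigroup μ t f) := by
  have hr₀ := Real.exp_pos (-t)
  have hr₁ : Real.exp (-t) < 1 := Real.exp_lt_one_iff.2 (neg_neg_of_pos ht)
  obtain ⟨B, hBc, hB⟩ := exists_continuous_abs_kernel_le hμ hr₀ hr₁
  refine continuous_iff_continuousAt.2 fun x₀ => ?_
  have hBx₀ : ∀ᶠ x in 𝓝 x₀, B x < B x₀ + 1 :=
    hBc.continuousAt.eventually (gt_mem_nhds (lt_add_one (B x₀)))
  refine continuousAt_of_dominated (bound := fun y => (B x₀ + 1) * ‖f y‖)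
    (.of_forall fun x => (integrable_kernel_smul hμ hr₀ hr₁ hf x).aestronglyMeasurable) ?_
    (hf.norm.const_mul _) (.of_forall fun y => ?_)
  · filter_upwards [hBx₀] with x hx
    refine .of_forall fun y => ?_
    rw [norm_smul]
    gcongr
    exact (hB x y).trans hx.le
  · have hK : Continuous fun x => kernel μ (Real.exp (-t)) x y :=
      (continuous_kernel hμ _).comp (.prodMk_left y)
    exact (hK.smul continuous_const).continuousAt

lemma measurable_maximal {μ : ℝ} (hμ : -1 / 2 < μ) {f : ℝ → 𝕜} (hf : Integrable f (lam μ)) :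
    Measurable (maximal μ f) :=
  (lowerSemicontinuous_biSup fun _ ht =>
    (continuous_semigroup hμ ht hf).enorm.lowerSemicontinuous).measurable

/-- The image of the measure `|f| dλ_μ` under `y ↦ |y|`, through which `f` enters the bound for its
maximal function: `|K_r(x, y)|` is dominated by a function of `|y|`. -/
noncomputable def foldedMeasure (μ : ℝ) (f : ℝ → 𝕜) : Measure ℝ :=
  ((lam μ).withDensity fun y => ‖f y‖ₑ).map abs

lemma foldedMeasure_univ (μ : ℝ) {f : ℝ → 𝕜} (hf : Integrable f (lam μ)) :
    foldedMeasure μ f univ = ENNReal.ofReal (∫ y, ‖f y‖ ∂(lam μ)) := by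
  rw [foldedMeasure, Measure.map_apply (by fun_prop) .univ, preimage_univ,
    withDensity_apply _ .univ, Measure.restrict_univ, ofReal_integral_norm_eq_lintegral_enorm hf]

lemma foldedMeasure_le (μ : ℝ) (f : ℝ → 𝕜) :
    foldedMeasure μ f ≤ eLpNorm f ∞ (lam μ) • (lam μ).map abs := by
  rw [← Measure.map_smul, foldedMeasure, ← withDensity_const, eLpNorm_exponent_top]
  exact Measure.map_mono (withDensity_mono ae_le_eLpNormEssSup) (by fun_prop)

lemma lintegral_foldedMeasure {μ : ℝ} {f : ℝ → 𝕜} (hf : AEStronglyMeasurable f (lam μ))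
    {g : ℝ → ℝ≥0∞} (hg : Measurable g) :
    ∫⁻ y, g y ∂(foldedMeasure μ f) = ∫⁻ y, ‖f y‖ₑ * g |y| ∂(lam μ) := by
  have habs : Measurable (abs : ℝ → ℝ) := by fun_prop
  rw [foldedMeasure, lintegral_map hg habs,
    lintegral_withDensity_eq_lintegral_mul₀ hf.enorm (g := fun y => g |y|)
      (hg.comp habs).aemeasurable]
  rfl

lemma exists_maximal_le_uncenteredMaximal {μ : ℝ} (hμ : -1 / 2 < μ) :
    ∃ C : ℝ, 0 < C ∧ ∀ f : ℝ → 𝕜, AEStronglyMeasurable f (lam μ) → ∀ x : ℝ,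
      maximal μ f x ≤
        ENNReal.ofReal C * uncenteredMaximal ((lam μ).map abs) (foldedMeasure μ f) |x| := by
  have := isFiniteMeasure_lam hμ
  obtain ⟨C, hC, hkernel⟩ := exists_abs_kernel_le_kernelMajorant hμ
  obtain ⟨D, hD, hmass⟩ := exists_lintegral_kernelMajorant_le hμ
  refine ⟨C * D, by positivity, fun f hf x => iSup₂_le fun t ht => ?_⟩
  set r := Real.exp (-t)
  have hr₀ : 0 < r := Real.exp_pos _
  have hr₁ : r < 1 := Real.exp_lt_one_iff.2 (neg_neg_of_pos ht)
  set M := uncenteredMaximal ((lam μ).map abs) (foldedMeasure μ f) |x|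
  rcases eq_or_ne M ∞ with htop | htop
  · rw [htop, ENNReal.mul_top (ENNReal.ofReal_pos.2 (by positivity)).ne']
    exact le_top
  set F := kernelMajorant μ r |x|
  have hF : Measurable F := measurable_kernelMajorant μ r |x|
  calc ‖semigroup μ t f x‖ₑ ≤ ∫⁻ y, ‖kernel μ r x y • f y‖ₑ ∂(lam μ) :=
        enorm_integral_le_lintegral_enorm _
    _ ≤ ∫⁻ y, ENNReal.ofReal C * (‖f y‖ₑ * ENNReal.ofReal (F |y|)) ∂(lam μ) := by
        refine lintegral_mono fun y => ?_
        rw [enorm_smul, mul_left_comm, mul_comm, ← ENNReal.ofReal_mul hC.le,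
          Real.enorm_eq_ofReal_abs]
        gcongr
        exact hkernel r x y hr₀ hr₁
    _ = ENNReal.ofReal C * ∫⁻ y, ENNReal.ofReal (F y) ∂(foldedMeasure μ f) := by
        rw [lintegral_const_mul' _ _ ENNReal.ofReal_ne_top,
          lintegral_foldedMeasure hf hF.ennreal_ofReal]
    _ ≤ ENNReal.ofReal C * (M * ∫⁻ y, ENNReal.ofReal (F y) ∂((lam μ).map abs)) := by
        gcongr
        exact (unimodalAt_kernelMajorant hr₀ hr₁ μ |x|).lintegral_le_uncenteredMaximal_mul hF
          (kernelMajorant_nonneg hr₀ hr₁ μ |x|) htop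
    _ ≤ ENNReal.ofReal C * (M * ENNReal.ofReal D) := by
        rw [lintegral_map hF.ennreal_ofReal (by fun_prop)]
        gcongr
        exact hmass r |x| hr₀ hr₁ (abs_nonneg x)
    _ = ENNReal.ofReal (C * D) * M := by
        rw [ENNReal.ofReal_mul hC.le, mul_comm M, mul_assoc]

lemma exists_weak_type_maximal {μ : ℝ} (hμ : -1 / 2 < μ) :
    ∃ C : ℝ, 0 < C ∧ ∀ f : ℝ → 𝕜, Integrable f (lam μ) → ∀ η : ℝ, 0 < η →
      lam μ {x : ℝ | ENNReal.ofReal η < maximal μ f x} ≤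
        ENNReal.ofReal (C / η * ∫ y, ‖f y‖ ∂(lam μ)) := by
  have := isFiniteMeasure_lam hμ
  obtain ⟨C, hC, hle⟩ := exists_maximal_le_uncenteredMaximal (𝕜 := 𝕜) hμ
  refine ⟨2 * C, by positivity, fun f hf η hη => ?_⟩
  have hηC : 0 < η / C := div_pos hη hC
  set E := {x | ENNReal.ofReal (η / C) <
    uncenteredMaximal ((lam μ).map abs) (foldedMeasure μ f) x}
  have hsub : {x | ENNReal.ofReal η < maximal μ f x} ⊆ abs ⁻¹' E := fun x hx => by
    rw [mem_preimage, mem_ofPred_eq, ENNReal.ofReal_div_of_pos hC]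
    exact ENNReal.div_lt_of_lt_mul' (lt_of_lt_of_le hx (hle f hf.1 x))
  have hweak := mul_measure_lt_uncenteredMaximal_le ((lam μ).map abs) (foldedMeasure μ f)
    (ENNReal.ofReal (η / C))
  rw [foldedMeasure_univ μ hf, ← ENNReal.ofReal_ofNat, ← ENNReal.ofReal_mul zero_le_two] at hweak
  calc lam μ {x | ENNReal.ofReal η < maximal μ f x} ≤ lam μ (abs ⁻¹' E) := measure_mono hsub
    _ ≤ (lam μ).map abs E := Measure.le_map_apply (by fun_prop) E
    _ ≤ ENNReal.ofReal (2 * ∫ y, ‖f y‖ ∂(lam μ)) / ENNReal.ofReal (η / C) := by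
        rwa [ENNReal.le_div_iff_mul_le (.inl (ENNReal.ofReal_pos.2 hηC).ne')
          (.inl ENNReal.ofReal_ne_top), mul_comm]
    _ = ENNReal.ofReal (2 * C / η * ∫ y, ‖f y‖ ∂(lam μ)) := by
        rw [← ENNReal.ofReal_div_of_pos hηC]
        congr 1
        field_simp

lemma exists_eLpNorm_top_maximal_le {μ : ℝ} (hμ : -1 / 2 < μ) :
    ∃ C : ℝ, 0 < C ∧ ∀ f : ℝ → 𝕜, AEStronglyMeasurable f (lam μ) →
      eLpNorm (maximal μ f) ∞ (lam μ) ≤ ENNReal.ofReal C * eLpNorm f ∞ (lam μ) := by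
  obtain ⟨C, hC, hle⟩ := exists_maximal_le_uncenteredMaximal (𝕜 := 𝕜) hμ
  refine ⟨C, hC, fun f hf => ?_⟩
  have hbound (x : ℝ) : maximal μ f x ≤ ENNReal.ofReal C * eLpNorm f ∞ (lam μ) := by
    refine (hle f hf x).trans ?_
    gcongr
    exact uncenteredMaximal_le_of_le_smul (foldedMeasure_le μ f) |x|
  rw [eLpNorm_exponent_top]
  exact essSup_le_of_ae_le _ (.of_forall hbound)

end Maximal

end GenOU

theorem theorem2p1 {𝕜 : Type*} [RCLike 𝕜] (μ : ℝ) (hμ : -1 / 2 < μ) :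
    -- the integrals defining `T_μ^t f(x)` converge absolutely and `T_μ^* f` is measurable
    (∀ f : ℝ → 𝕜, Integrable f (GenOU.lam μ) →
      (∀ t : ℝ, 0 < t → ∀ x : ℝ,
        Integrable (fun y => GenOU.kernel μ (Real.exp (-t)) x y • f y) (GenOU.lam μ)) ∧
      Measurable (GenOU.maximal μ f)) ∧
    -- weak type (1,1)
    (∃ C : ℝ, 0 < C ∧ ∀ f : ℝ → 𝕜, Integrable f (GenOU.lam μ) → ∀ η : ℝ, 0 < η →
      GenOU.lam μ {x : ℝ | ENNReal.ofReal η < GenOU.maximal μ f x} ≤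
        ENNReal.ofReal (C / η * ∫ y, ‖f y‖ ∂(GenOU.lam μ))) ∧
    -- boundedness on `L^∞`; as `λ_μ` is finite, `L^∞ ⊆ L¹` and the first part applies here too
    (∃ C : ℝ, 0 < C ∧ ∀ f : ℝ → 𝕜, MemLp f ∞ (GenOU.lam μ) →
      eLpNorm (GenOU.maximal μ f) ∞ (GenOU.lam μ) ≤
        ENNReal.ofReal C * eLpNorm f ∞ (GenOU.lam μ)) := by
  obtain ⟨C, hC, hbound⟩ := GenOU.exists_eLpNorm_top_maximal_le (𝕜 := 𝕜) hμ
  refine ⟨fun f hf => ⟨fun t ht x => ?_, GenOU.measurable_maximal hμ hf⟩,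
    GenOU.exists_weak_type_maximal hμ, C, hC, fun f hf => hbound f hf.aestronglyMeasurable⟩
  exact GenOU.integrable_kernel_smul hμ (Real.exp_pos _)
    (Real.exp_lt_one_iff.2 (neg_neg_of_pos ht)) hf x
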